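/- Let $A$ be a $C^*$-algebra (not necessarily unital), $H$ a Hilbert space, $\varphi:A\to L(H)$ a completely positive linear map, and $(\pi,H_\varphi,V_\varphi)$ a minimal Stinespring dilation triple of $\varphi$; that is, $\pi:A\to L(H_\varphi)$ is a $*$-homomorphism, $V_\varphi\in L(H,H_\varphi)$, $\varphi(a)=V_\varphi^*\pi(a)V_\varphi$ for all $a\in A$, and $H_\varphi$ is the closed linear span of $\{\pi(a)V_\varphi\xi : a\in A,\ \xi\in H\}$. Let $X$ be a (right) Hilbert $A$-module. For a linear map $\psi:A\to L(\mathcal E)$, a $\psi$-map on $X$ is a map $\Psi:X\to L(\mathcal E,\mathcal F)$ with $\mathcal F$ a Hilbert space and $\Psi(x)^*\Psi(y)=\psi(\langle x,y\rangle)$ for all $x,y\in X$; when $\psi$ is a $*$-homomorphism it is called a $\psi$-representation. Let $X_\varphi$ denote the ternary domain of $\varphi$ on $X$, that is, the module domain $$X_\varphi=X_\Psi:=\{x\in X : \Psi(xb)=\Psi(x)\varphi(b)\ \text{ for all } b\in A\}$$ of an arbitrary $\varphi$-map $\Psi$ on $X$ (this set is the same for every $\varphi$-map $\Psi$ on $X$).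 Then for every $\pi$-representation $\Pi:X\to L(H_\varphi,K)$ and every $\varphi$-map $\Phi:X\to L(H,\widetilde K)$ there is a partial isometry $W:\widetilde K\to K$ such that $\Phi(x)=W^*\Pi(x)V_\varphi$ for all $x\in X$ and such that, for every $x\in X$, the following statements are equivalent: 1. $x\in X_\varphi$; 2. $\Pi(x)(\mathrm{id}_{H_\varphi}-V_\varphi V_\varphi^*)=0$; 3. $W^*\Pi(x)=\Phi(x)V_\varphi^*$; 4. $\Pi(x)=W\Phi(x)V_\varphi^*$. -/

import Mathlib

open scoped CStarAlgebra RightActions InnerProductSpace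

noncomputable section

namespace TernaryDomain

/-! Right Hilbert `C⋆`-modules.  Mathlib's class `CStarModule B X` asks for
`⟪x, b • y⟫ = b * ⟪x, y⟫`.  A right Hilbert module over `A`, with
`⟪x, y a⟫ = ⟪x, y⟫ a`, is therefore a `CStarModule` over the opposite algebra `Aᵐᵒᵖ`; the right
action `y a` is `y <• a`, that is, `MulOpposite.op a • y`. -/

section HilbertModule

variable {A : Type*} [NonUnitalCStarAlgebra A] [PartialOrder A]
  {X : Type*} [NormedAddCommGroup X] [NormedSpace ℂ X] [SMul Aᵐᵒᵖ X] [CStarModule Aᵐᵒᵖ X]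

variable (A) in
/-- The `A`-valued inner product of a right Hilbert module over `A`. -/
def inn (x y : X) : A := MulOpposite.unop (inner Aᵐᵒᵖ x y)

theorem inn_smul_right (x y : X) (a : A) : inn A x (y <• a) = inn A x y * a := by
  simp [inn]

theorem inn_add_right (x y z : X) : inn A x (y + z) = inn A x y + inn A x z := by
  simp [inn]

theorem inn_smul_right_complex (c : ℂ) (x y : X) : inn A x (c • y) = c • inn A x y := by
  simp [inn]

theorem star_inn (x y : X) : star (inn A x y) = inn A y x := by
  rw [inn, inn, ← MulOpposite.unop_star, CStarModule.star_inner]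

theorem inn_self_nonneg (x : X) : 0 ≤ inn A x x :=
  CStarModule.inner_self_nonneg (A := Aᵐᵒᵖ) (x := x)

theorem inn_self_eq_zero (x : X) : inn A x x = 0 ↔ x = 0 := by
  rw [inn, MulOpposite.unop_eq_zero_iff, CStarModule.inner_self]

theorem norm_eq_sqrt_norm_inn (x : X) : ‖x‖ = √‖inn A x x‖ :=
  CStarModule.norm_eq_sqrt_norm_inner_self (A := Aᵐᵒᵖ) x

theorem inn_zero_right (x : X) : inn A x 0 = 0 := by
  simpa using inn_add_right (A := A) x 0 0

theorem inn_sub_right (x y z : X) : inn A x (y - z) = inn A x y - inn A x z := by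
  rw [eq_sub_iff_add_eq, ← inn_add_right, sub_add_cancel]

theorem ext_inn {x y : X} (h : ∀ z : X, inn A z x = inn A z y) : x = y := by
  rw [← sub_eq_zero, ← inn_self_eq_zero (A := A), inn_sub_right, h, sub_self]

/-! The laws of a right module follow from the properties of the inner product. -/

theorem smul_smul_eq (x : X) (a b : A) : (x <• a) <• b = x <• (a * b) :=
  ext_inn (A := A) fun z => by simp only [inn_smul_right, mul_assoc]

theorem add_smul_eq (x y : X) (a : A) : (x + y) <• a = x <• a + y <• a :=
  ext_inn (A := A) fun z => by simp only [inn_smul_right, inn_add_right, add_mul]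

theorem smul_add_eq (x : X) (a b : A) : x <• (a + b) = x <• a + x <• b :=
  ext_inn (A := A) fun z => by simp only [inn_smul_right, inn_add_right, mul_add]

theorem smul_complex_smul_eq (c : ℂ) (x : X) (a : A) : (c • x) <• a = c • (x <• a) :=
  ext_inn (A := A) fun z => by
    simp only [inn_smul_right, inn_smul_right_complex, smul_mul_assoc]

end HilbertModule

section Operators

variable {H K : Type*} [NormedAddCommGroup H] [InnerProductSpace ℂ H] [CompleteSpace H]
  [NormedAddCommGroup K] [InnerProductSpace ℂ K] [CompleteSpace K]

/-- `W` is a partial isometry: `W W* W = W`. -/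
def IsPartialIsometry (W : H →L[ℂ] K) : Prop :=
  W ∘L W.adjoint ∘L W = W

variable {A : Type*} [NonUnitalCStarAlgebra A] [PartialOrder A]
  {X : Type*} [NormedAddCommGroup X] [NormedSpace ℂ X] [SMul Aᵐᵒᵖ X] [CStarModule Aᵐᵒᵖ X]

/-- `Φ : X → L(H, K)` is a `φ`-map: `Φ(x)* Φ(y) = φ(⟨x, y⟩)` for all `x, y`.
If `φ` is a `*`-homomorphism, this says that `Φ` is a `φ`-representation. -/
def IsPhiMap (φ : A → (H →L[ℂ] H)) (Φ : X → (H →L[ℂ] K)) : Prop :=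
  ∀ x y : X, (Φ x).adjoint ∘L Φ y = φ (inn A x y)

/-- The `φ`-module domain `X_Φ = {x ∈ X : Φ(x b) = Φ(x) φ(b) for all b ∈ A}`. -/
def moduleDomain (φ : A → (H →L[ℂ] H)) (Φ : X → (H →L[ℂ] K)) : Set X :=
  {x | ∀ b : A, Φ (x <• b) = Φ x ∘L φ b}

/-- `(π, K, V)` is a minimal Stinespring dilation triple of `φ`: `φ(a) = V* π(a) V` for all `a`,
and the closed linear span of `{π(a) V ξ : a ∈ A, ξ ∈ H}` is `K`. -/
structure IsMinimalStinespring (φ : A → (H →L[ℂ] H)) (π : A →⋆ₙₐ[ℂ] (K →L[ℂ] K))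
    (V : H →L[ℂ] K) : Prop where
  dilation : ∀ a : A, φ a = V.adjoint ∘L π a ∘L V
  minimal : (Submodule.span ℂ {η : K | ∃ (a : A) (ξ : H), η = π a (V ξ)}).topologicalClosure = ⊤

end Operators

end TernaryDomain

end

/-!
Since `Φ(x)* Φ(y) = φ(⟨x, y⟩) = V* π(⟨x, y⟩) V = (Π(x) V)* (Π(y) V)`, the families of vectors
`Φ(x) ξ` and `Π(x) V ξ` have the same Gram matrix. Hence `Φ(x) ξ ↦ Π(x) V ξ` extends to a partial
isometry `W` whose initial space is the closed span of the `Φ(x) ξ`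
(`exists_isPartialIsometry_of_inner_eq`), with `W Φ(x) = Π(x) V` and `W* Π(x) V = Φ(x)`.
Moreover `Π(x a) = Π(x) π(a)`, so minimality of the dilation puts the ranges of all the `Π(x)`
into the final space of `W`: `W W* Π(x) = Π(x)` (`exists_intertwining_isPartialIsometry`).

These relations give the equivalence of `Π(x) = Π(x) V V*`, `W* Π(x) = Φ(x) V*` and
`Π(x) = W Φ(x) V*` by composition. For a `φ`-map `Ψ`, with its own partial isometry `U`,
`Ψ(x b) - Ψ(x) φ(b) = U* Π(x) (1 - V V*) π(b) V`. As `U*` is injective on the ranges of the `Π(x)`,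
and as the `π(b) V ξ` span a dense subspace, this vanishes for all `b` if and only if
`Π(x) (1 - V V*) = 0`. In particular, the module domain does not depend on `Ψ`.
-/

namespace TernaryDomain

open ContinuousLinearMap

section PartialIsometry

variable {H K : Type*} [NormedAddCommGroup H] [InnerProductSpace ℂ H] [CompleteSpace H]
  [NormedAddCommGroup K] [InnerProductSpace ℂ K] [CompleteSpace K]

/-- Linear maps `S` and `T` on the same space with `‖T c‖ = ‖S c‖` are intertwined by a partial
isometry `W`: the projection onto the closure of `range S`, followed by the isometric extension of
`S c ↦ T c` to that closure. -/
theorem exists_isPartialIsometry_of_norm_eq {E : Type*} [AddCommGroup E] [Module ℂ E]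
    (S : E →ₗ[ℂ] H) (T : E →ₗ[ℂ] K) (h : ∀ c, ‖T c‖ = ‖S c‖) :
    ∃ W : H →L[ℂ] K, IsPartialIsometry W ∧ (∀ c, W (S c) = T c) ∧
      ∀ c, W.adjoint (T c) = S c := by
  let M : Submodule ℂ H := (LinearMap.range S).topologicalClosure
  have : CompleteSpace M := (Submodule.isClosed_topologicalClosure _).completeSpace_coe
  let e : E →ₗ[ℂ] M :=
    S.codRestrict M fun c => Submodule.le_topologicalClosure _ (LinearMap.mem_range_self S c)
  have hdense : DenseRange e := by
    rw [DenseRange, Subtype.dense_iff]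
    intro y hy
    have himage : ((↑) : M → H) '' Set.range e = LinearMap.range S := by
      rw [← Set.range_comp]
      rfl
    change y ∈ closure (((↑) : M → H) '' Set.range e)
    rw [himage]
    exact hy
  have hnorm : ∀ c, ‖T c‖ = ‖e c‖ := h
  have hbound : ∃ C : ℝ, ∀ c, ‖T c‖ ≤ C * ‖e c‖ := ⟨1, fun c => by rw [one_mul, hnorm]⟩
  let J : M →L[ℂ] K := T.extendOfNorm e
  have hJ : ∀ c, J (e c) = T c := LinearMap.extendOfNorm_eq hdense hbound
  have hJnorm : ∀ y, ‖J y‖ = ‖y‖ := fun y =>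
    hdense.induction_on (p := fun y => ‖J y‖ = ‖y‖) y
      (isClosed_eq (by fun_prop) (by fun_prop)) fun c => by rw [hJ, hnorm]
  have hJJ : ∀ y, J.adjoint (J y) = y := fun y =>
    congr($(J.norm_map_iff_adjoint_comp_self.mp hJnorm) y)
  have hP : ∀ c, M.orthogonalProjectionOnto (S c) = e c := fun c =>
    Submodule.orthogonalProjectionOnto_mem_subspace_eq_self (e c)
  have hadj : (J ∘L M.orthogonalProjectionOnto).adjoint = M.subtypeL ∘L J.adjoint := by
    rw [adjoint_comp, Submodule.adjoint_orthogonalProjectionOnto]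
  refine ⟨J ∘L M.orthogonalProjectionOnto, ?_, fun c => ?_, fun c => ?_⟩
  · rw [IsPartialIsometry, hadj]
    ext y
    simp only [comp_apply, hJJ, Submodule.subtypeL_apply,
      Submodule.orthogonalProjectionOnto_mem_subspace_eq_self]
  · rw [comp_apply, hP, hJ]
  · rw [hadj, comp_apply, ← hJ, hJJ]
    rfl

/-- Two families of vectors with the same Gram matrix are intertwined by a partial isometry. -/
theorem exists_isPartialIsometry_of_inner_eq {ι : Type*} (f : ι → H) (g : ι → K)
    (h : ∀ i j, ⟪g i, g j⟫_ℂ = ⟪f i, f j⟫_ℂ) :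
    ∃ W : H →L[ℂ] K, IsPartialIsometry W ∧ (∀ i, W (f i) = g i) ∧
      ∀ i, W.adjoint (g i) = f i := by
  obtain ⟨W, hW, hWf, hWg⟩ := exists_isPartialIsometry_of_norm_eq
    (Finsupp.linearCombination ℂ f) (Finsupp.linearCombination ℂ g) fun c => by
      have hinner : ⟪Finsupp.linearCombination ℂ g c, Finsupp.linearCombination ℂ g c⟫_ℂ =
          ⟪Finsupp.linearCombination ℂ f c, Finsupp.linearCombination ℂ f c⟫_ℂ := by
        simp only [Finsupp.linearCombination_apply, Finsupp.sum_inner, Finsupp.inner_sum,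
            inner_smul_left, inner_smul_right, h]
      rw [@norm_eq_sqrt_re_inner ℂ, @norm_eq_sqrt_re_inner ℂ, hinner]
  refine ⟨W, hW, fun i => ?_, fun i => ?_⟩
  · simpa using hWf (Finsupp.single i 1)
  · simpa using hWg (Finsupp.single i 1)

end PartialIsometry

section PhiMap

variable {A : Type*} [NonUnitalCStarAlgebra A]
  {H : Type*} [NormedAddCommGroup H] [InnerProductSpace ℂ H] [CompleteSpace H]
  {Hφ : Type*} [NormedAddCommGroup Hφ] [InnerProductSpace ℂ Hφ] [CompleteSpace Hφ]
  {K : Type*} [NormedAddCommGroup K] [InnerProductSpace ℂ K] [CompleteSpace K]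
  {φ : A → (H →L[ℂ] H)} {π : A →⋆ₙₐ[ℂ] (Hφ →L[ℂ] Hφ)} {V : H →L[ℂ] Hφ}

/-- By minimality, an operator on the dilation space is determined by its values on the
vectors `π(a) V ξ`. -/
theorem IsMinimalStinespring.ext_comp (hV : IsMinimalStinespring φ π V) {F : Type*}
    [NormedAddCommGroup F] [NormedSpace ℂ F] {S T : Hφ →L[ℂ] F}
    (h : ∀ a, S ∘L π a ∘L V = T ∘L π a ∘L V) : S = T := by
  refine ContinuousLinearMap.ext_on
    (Submodule.dense_iff_topologicalClosure_eq_top.mpr hV.minimal) ?_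
  rintro _ ⟨a, ξ, rfl⟩
  exact congr($(h a) ξ)

variable [PartialOrder A]
  {X : Type*} [NormedAddCommGroup X] [NormedSpace ℂ X] [SMul Aᵐᵒᵖ X] [CStarModule Aᵐᵒᵖ X]

/-- A representation of a Hilbert module on Hilbert spaces is a module map. -/
theorem IsPhiMap.map_smul {R : X → (Hφ →L[ℂ] K)} (hR : IsPhiMap (A := A) π R) (x : X) (a : A) :
    R (x <• a) = R x ∘L π a := by
  have hleft : inn A (x <• a) x = star a * inn A x x := by
    rw [← star_inn, inn_smul_right, star_mul, star_inn]
  -- With `D = R(x a) - R(x) π(a)`, expanding `D* D` gives four equal terms of alternating sign.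
  rw [← sub_eq_zero, ← adjoint_comp_self_eq_zero_iff, map_sub, adjoint_comp, sub_comp, comp_sub,
    comp_sub, hR, comp_assoc, ← comp_assoc _ _ (π a), hR, ← comp_assoc _ (R x) (π a), comp_assoc _ _ (R x), hR, hR,
    inn_smul_right, inn_smul_right, hleft, ← star_eq_adjoint, ← map_star]
  simp only [← mul_def, ← map_mul, mul_assoc, sub_self]

/-- A `φ`-map `Φ` and a `π`-representation `R` are intertwined by a partial isometry whose final
space contains the range of every `R x`. -/
theorem exists_intertwining_isPartialIsometry (hV : IsMinimalStinespring φ π V)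
    {R : X → (Hφ →L[ℂ] K)} (hR : IsPhiMap (A := A) π R)
    {K' : Type*} [NormedAddCommGroup K'] [InnerProductSpace ℂ K'] [CompleteSpace K']
    {Φ : X → (H →L[ℂ] K')} (hΦ : IsPhiMap (A := A) φ Φ) :
    ∃ W : K' →L[ℂ] K, IsPartialIsometry W ∧ (∀ x, W ∘L Φ x = R x ∘L V) ∧
      (∀ x, W.adjoint ∘L R x ∘L V = Φ x) ∧ ∀ x, W ∘L W.adjoint ∘L R x = R x := by
  obtain ⟨W, hW, hWΦ, hWR⟩ := exists_isPartialIsometry_of_inner_eq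
    (fun p : X × H => Φ p.1 p.2) (fun p : X × H => R p.1 (V p.2)) fun p q => by
      have hΦpq : (Φ p.1).adjoint (Φ q.1 q.2) = φ (inn A p.1 q.1) q.2 :=
        congr($(hΦ p.1 q.1) q.2)
      have hRpq : (R p.1).adjoint (R q.1 (V q.2)) = π (inn A p.1 q.1) (V q.2) :=
        congr($(hR p.1 q.1) (V q.2))
      rw [← adjoint_inner_right, ← adjoint_inner_right, ← adjoint_inner_right, hΦpq, hRpq,
        hV.dilation]
      rfl
  have hWΦ' : ∀ x, W ∘L Φ x = R x ∘L V := fun x => by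
    ext ξ
    exact hWΦ (x, ξ)
  refine ⟨W, hW, hWΦ', fun x => ?_, fun x => hV.ext_comp fun a => ?_⟩
  · ext ξ
    exact hWR (x, ξ)
  · have hRa : R x ∘L π a ∘L V = W ∘L Φ (x <• a) := by
      rw [hWΦ', hR.map_smul, comp_assoc]
    rw [comp_assoc, comp_assoc, hRa, ← comp_assoc W.adjoint, ← comp_assoc W, hW]

/-- The description of the module domain of a `φ`-map in terms of any `π`-representation `R`;
the condition on `R` does not involve the `φ`-map. -/
theorem mem_moduleDomain_iff (hV : IsMinimalStinespring φ π V)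
    {R : X → (Hφ →L[ℂ] K)} (hR : IsPhiMap (A := A) π R)
    {K' : Type*} [NormedAddCommGroup K'] [InnerProductSpace ℂ K'] [CompleteSpace K']
    {Ψ : X → (H →L[ℂ] K')} (hΨ : IsPhiMap (A := A) φ Ψ) (x : X) :
    x ∈ moduleDomain (A := A) φ Ψ ↔ R x = R x ∘L V ∘L V.adjoint := by
  obtain ⟨U, -, hUΨ, hUR, hUU⟩ := exists_intertwining_isPartialIsometry hV hR hΨ
  constructor
  · refine fun hx => hV.ext_comp fun a => ?_
    calc R x ∘L π a ∘L V = U ∘L Ψ (x <• a) := by rw [hUΨ, hR.map_smul, comp_assoc]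
      _ = U ∘L Ψ x ∘L φ a := by rw [hx a]
      _ = (R x ∘L V ∘L V.adjoint) ∘L π a ∘L V := by
        rw [← comp_assoc, hUΨ, hV.dilation]
        simp only [comp_assoc]
  · intro hx b
    calc Ψ (x <• b) = U.adjoint ∘L R x ∘L π b ∘L V := by
          rw [← hUR, hR.map_smul, comp_assoc]
      _ = U.adjoint ∘L (R x ∘L V ∘L V.adjoint) ∘L π b ∘L V := by rw [← hx]
      _ = Ψ x ∘L φ b := by
        rw [← hUR x, hV.dilation]
        simp only [comp_assoc]

end PhiMap

end TernaryDomain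

/-- The ternary domain `X_φ` is the `φ`-module domain of any `φ`-map on `X`, so the equivalences
are stated for the module domain of an arbitrary `φ`-map `Ψ` on `X` (`Ψ = Φ` is allowed). -/
theorem mainTheorem8
    {A : Type*} [NonUnitalCStarAlgebra A] [PartialOrder A] [StarOrderedRing A]
    {H : Type*} [NormedAddCommGroup H] [InnerProductSpace ℂ H] [CompleteSpace H]
    (φ : A →CP (H →L[ℂ] H))
    {Hφ : Type*} [NormedAddCommGroup Hφ] [InnerProductSpace ℂ Hφ] [CompleteSpace Hφ]
    (π : A →⋆ₙₐ[ℂ] (Hφ →L[ℂ] Hφ)) (V : H →L[ℂ] Hφ)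
    (hV : TernaryDomain.IsMinimalStinespring φ π V)
    {X : Type*} [NormedAddCommGroup X] [NormedSpace ℂ X] [CompleteSpace X]
    [SMul Aᵐᵒᵖ X] [CStarModule Aᵐᵒᵖ X]
    {K : Type*} [NormedAddCommGroup K] [InnerProductSpace ℂ K] [CompleteSpace K]
    (R : X → (Hφ →L[ℂ] K)) (hR : TernaryDomain.IsPhiMap (A := A) π R)
    {K' : Type*} [NormedAddCommGroup K'] [InnerProductSpace ℂ K'] [CompleteSpace K']
    (Φ : X → (H →L[ℂ] K')) (hΦ : TernaryDomain.IsPhiMap (A := A) φ Φ) :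
    ∃ W : K' →L[ℂ] K, TernaryDomain.IsPartialIsometry W ∧
      (∀ x : X, Φ x = W.adjoint ∘L R x ∘L V) ∧
      ∀ {K'' : Type*} [NormedAddCommGroup K''] [InnerProductSpace ℂ K''] [CompleteSpace K'']
        (Ψ : X → (H →L[ℂ] K'')), TernaryDomain.IsPhiMap (A := A) φ Ψ →
        ∀ x : X, List.TFAE [
          x ∈ TernaryDomain.moduleDomain (A := A) φ Ψ,
          R x ∘L (ContinuousLinearMap.id ℂ Hφ - V ∘L V.adjoint) = 0,
          W.adjoint ∘L R x = Φ x ∘L V.adjoint,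
          R x = W ∘L Φ x ∘L V.adjoint] := by
  obtain ⟨W, hW, hWΦ, hWR, hWW⟩ :=
    TernaryDomain.exists_intertwining_isPartialIsometry hV hR hΦ
  refine ⟨W, hW, fun x => (hWR x).symm, fun Ψ hΨ x => ?_⟩
  tfae_have 1 ↔ 2 := by
    rw [TernaryDomain.mem_moduleDomain_iff hV hR hΨ, ContinuousLinearMap.comp_sub,
      ContinuousLinearMap.comp_id, sub_eq_zero]
  tfae_have 2 → 3 := by
    rw [ContinuousLinearMap.comp_sub, ContinuousLinearMap.comp_id, sub_eq_zero]
    intro h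
    rw [h, ← hWR x]
    simp only [ContinuousLinearMap.comp_assoc]
  tfae_have 3 → 4 := fun h => by rw [← h, hWW]
  tfae_have 4 → 2 := fun h => by
    rw [ContinuousLinearMap.comp_sub, ContinuousLinearMap.comp_id, sub_eq_zero,
      ← ContinuousLinearMap.comp_assoc, ← hWΦ, ContinuousLinearMap.comp_assoc]
    exact h
  tfae_finish
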